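/- All graphs are finite and simple. A signed graph $(G,\sigma)$ is a graph $G$ with a signature $\sigma: E(G)\to\{+,-\}$; a closed walk is positive if it has an even number of negative edges (counted with multiplicity), and negative otherwise. A homomorphism $(G,\sigma)\to(H,\pi)$ of signed graphs is a map $V(G)\to V(H)$ that preserves adjacency and the signs of closed walks; an isomorphism is a bijective homomorphism whose inverse is also a homomorphism. A signed graph $(T,\lambda)$ is a bound of a family $\mathcal F$ of graphs if $(G,\sigma)\to(T,\lambda)$ for every $G\in\mathcal F$ and every signature $\sigma$ of $G$. Let $\mathcal P_4$ be the family of triangle-free planar graphs. Let $(SP_5^+,\square^+)$ be the signed complete graph on the six vertices $\mathbb F_5\cup\{\infty\}$ in which every edge at $\infty$ is positive and, for distinct $u,v\in\mathbb F_5$, the edge $uv$ is positive if $u-v$ is a square in $\mathbb F_5$ and negative otherwise. **Theorem.** If a signed graph $(T,\lambda)$ on $6$ vertices is a bound of $\mathcal P_4$, then $(T,\lambda)$ is isomorphic to $(SP_5^+,\square^+)$. -/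

import Mathlib

/-- A signed graph on the vertex set `V`: a simple graph together with a signature, that is, a
function from its edges to the signs `{+, -}`, encoded as `{1, -1} = ℤˣ`. -/
structure SignedGraph (V : Type*) where
  graph : SimpleGraph V
  sign : graph.EdgeLabeling ℤˣ

namespace SignedGraph

variable {V W : Type*}

/-- The sign of a walk: the product, with multiplicity, of the signs of its edges. It is `1` iff
the walk has an even number of negative edges. -/
def walkSign (G : SignedGraph V) : {u v : V} → G.graph.Walk u v → ℤˣ
  | _, _, .nil => 1
  | _, _, .cons h p => G.sign.get _ _ h * G.walkSign p

/-- A graph homomorphism between the underlying graphs preserves the signs of closed walks. -/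
def PreservesClosedWalkSigns (G : SignedGraph V) (H : SignedGraph W) (f : G.graph →g H.graph) :
    Prop :=
  ∀ (v : V) (p : G.graph.Walk v v), H.walkSign (p.map f) = G.walkSign p

/-- `(G, σ) → (H, π)`: there is a homomorphism of signed graphs, i.e. a vertex mapping preserving
adjacencies and the signs of closed walks. -/
def HomTo (G : SignedGraph V) (H : SignedGraph W) : Prop :=
  ∃ f : G.graph →g H.graph, PreservesClosedWalkSigns G H f

/-- Isomorphism of signed graphs: there is a bijective homomorphism of signed graphs whose inverse
is a homomorphism of signed graphs too. -/
def IsIsomorphic (G : SignedGraph V) (H : SignedGraph W) : Prop :=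
  ∃ f : G.graph ≃g H.graph,
    PreservesClosedWalkSigns G H f.toHom ∧ PreservesClosedWalkSigns H G f.symm.toHom

/-- The signed Paley graph `(SP_q, □)`, `q ≡ 1 mod 4`: the vertices are the elements of the field
with `q` elements, all pairs of distinct vertices are adjacent, and the edge `xy` is positive iff
`x - y` is a square. -/
noncomputable def paley (F : Type*) [Field F] [Fintype F] (hF : Fintype.card F % 4 = 1) :
    SignedGraph F where
  graph := ⊤
  sign := open Classical in
    SimpleGraph.EdgeLabeling.mk (fun x y _ => if IsSquare (x - y) then 1 else -1) (by
      intro x y _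
      have h : IsSquare (-1 : F) := FiniteField.isSquare_neg_one_iff.2 (by omega)
      have key : IsSquare (y - x) ↔ IsSquare (x - y) :=
        ⟨fun h' => by simpa using h.mul h', fun h' => by simpa using h.mul h'⟩
      by_cases hx : IsSquare (x - y)
      · rw [if_pos hx, if_pos (key.2 hx)]
      · rw [if_neg hx, if_neg (fun h' => hx (key.1 h'))])

/-- Add to a signed graph a new vertex `∞` (here `none`) joined to every other vertex by a
positive edge. -/
def addUniversalPositive (G : SignedGraph V) : SignedGraph (Option V) where
  graph :=
    { Adj := fun x y => match x, y with
        | none, none => False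
        | none, some _ => True
        | some _, none => True
        | some u, some v => G.graph.Adj u v
      symm := ⟨fun x y h => match x, y, h with
        | none, some _, _ => trivial
        | some _, none, _ => trivial
        | some _, some _, h => SimpleGraph.Adj.symm (G := G.graph) h⟩
      loopless := ⟨fun x h => match x, h with
        | some u, h => G.graph.loopless.irrefl u h⟩ }
  sign := SimpleGraph.EdgeLabeling.mk
    (fun x y h => match x, y, h with
      | none, some _, _ => 1
      | some _, none, _ => 1
      | some u, some v, h => G.sign.get u v h)
    (fun x y h => match x, y, h with
      | none, some _, _ => rfl
      | some _, none, _ => rfl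
      | some _, some _, h => G.sign.get_comm _ _ (SimpleGraph.Adj.symm (G := G.graph) h))

/-- The signed Paley plus graph `(SP_q^+, □^+)`, `q ≡ 1 mod 4`. -/
noncomputable def paleyPlus (F : Type*) [Field F] [Fintype F] (hF : Fintype.card F % 4 = 1) :
    SignedGraph (Option F) :=
  (paley F hF).addUniversalPositive

instance fact_prime_five : Fact (Nat.Prime 5) := ⟨Nat.prime_five⟩

/-- The signed Paley plus graph `(SP_5^+, □^+)`, a signed graph on six vertices. -/
noncomputable def paleyPlusFive : SignedGraph (Option (ZMod 5)) :=
  paleyPlus (ZMod 5) (by simp [ZMod.card])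

/-- A signed graph `T` is a (homomorphism) bound of a family of graphs if `(G, σ) → T` for every
graph `G` of the family and every signature `σ` of `G`. -/
def IsBound (T : SignedGraph W) (family : ∀ V : Type, SimpleGraph V → Prop) : Prop :=
  ∀ (V : Type) (G : SignedGraph V), family V G.graph → G.HomTo T

end SignedGraph

/-- A drawing of a graph in the plane: the vertices are distinct points, every edge `uv` is
a simple arc joining the points of `u` and `v`, an arc contains no vertices except for its ends,
and two arcs of distinct edges meet only in common ends. (`arc e` is irrelevant if `e` is
not an edge.) -/
structure PlaneDrawing {V : Type*} (G : SimpleGraph V) where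
  pos : V → ℝ × ℝ
  arc : Sym2 V → Set (ℝ × ℝ)
  pos_injective : Function.Injective pos
  isArc : ∀ u v, G.Adj u v →
    ∃ γ : Path (pos u) (pos v), Function.Injective γ ∧ Set.range γ = arc s(u, v)
  mem_of_pos_mem_arc : ∀ e ∈ G.edgeSet, ∀ w, pos w ∈ arc e → w ∈ e
  arc_inter : ∀ e ∈ G.edgeSet, ∀ e' ∈ G.edgeSet, e ≠ e' →
    ∀ p ∈ arc e ∩ arc e', ∃ w, w ∈ e ∧ w ∈ e' ∧ p = pos w

/-- A graph is planar if it can be drawn in the plane. -/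
def IsPlanarGraph {V : Type*} (G : SimpleGraph V) : Prop := Nonempty (PlaneDrawing G)

/-- The family of (finite) triangle-free planar graphs. -/
def triangleFreePlanar (V : Type) (G : SimpleGraph V) : Prop :=
  Finite V ∧ IsPlanarGraph G ∧ G.CliqueFree 3

/-! One planar bipartite signed graph, `witness`, already forces the target. The basic tool is that
opposite vertices of a negative 4-cycle have distinct images: identifying them would turn the cycle
into a closed walk using edges in equal-sign pairs. Such cycles make the two ends of a splitting and
its four common neighbours distinct, so with six vertices available they fill the target, and the
ends form a balanced pair (`IsSplit.exists_equiv`).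

A double balancer applies this again to the two pairs of common neighbours of equal sign. Its image
therefore partitions the target into three balanced pairs. Switching then leaves only `normalForm p
q r t`, where `p`, `q`, `r` describe the possible edges inside the pairs and `t` is a sign
(`exists_switching_normalForm`).

The witness has two double balancers sharing the vertex `0`, and a negative 4-cycle separates their
other ends. The second partition thus differs from the first, which forces `p ≠ 0`, `q = -p` and `r
= p` (`normalForm_eq`). The four remaining matrices are all switching equivalent to the Paley one
(`exists_equiv_normalForm`). Since isomorphism only sees signs of closed walks, switching
equivalence together with a bijection suffices (`isIsomorphic_of_switching`). -/

namespace SignedGraph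

/-! ### Signed adjacency matrices, 4-cycles and switching -/

/-- The signed adjacency matrix of a signed graph. -/
noncomputable def signedAdj {V : Type*} (G : SignedGraph V) (u v : V) : ℤ :=
  open Classical in if h : G.graph.Adj u v then (G.sign.get u v h : ℤ) else 0

/-- The product of the entries of `A` along the closed walk `x v y w`. -/
def quad {V : Type*} (A : V → V → ℤ) (x v y w : V) : ℤ :=
  A x v * A v y * (A x w * A w y)

section signedAdj

variable {V W : Type*} (G : SignedGraph V)

theorem signedAdj_of_adj {u v : V} (h : G.graph.Adj u v) :
    G.signedAdj u v = (G.sign.get u v h : ℤ) := by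
  simp [signedAdj, h]

theorem signedAdj_of_not_adj {u v : V} (h : ¬ G.graph.Adj u v) : G.signedAdj u v = 0 := by
  simp [signedAdj, h]

theorem adj_of_signedAdj_ne_zero {u v : V} (h : G.signedAdj u v ≠ 0) : G.graph.Adj u v := by
  by_contra h'
  exact h (G.signedAdj_of_not_adj h')

theorem signedAdj_ne_zero_iff {u v : V} : G.signedAdj u v ≠ 0 ↔ G.graph.Adj u v :=
  ⟨G.adj_of_signedAdj_ne_zero, fun h => by simp [G.signedAdj_of_adj h]⟩

theorem signedAdj_comm (u v : V) : G.signedAdj u v = G.signedAdj v u := by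
  by_cases h : G.graph.Adj u v
  · rw [G.signedAdj_of_adj h, G.signedAdj_of_adj h.symm, G.sign.get_comm]
  · rw [G.signedAdj_of_not_adj h, G.signedAdj_of_not_adj fun h' => h h'.symm]

theorem signedAdj_self (u : V) : G.signedAdj u u = 0 :=
  G.signedAdj_of_not_adj (G.graph.loopless.irrefl u)

theorem signedAdj_mem (u v : V) : G.signedAdj u v ∈ ({-1, 0, 1} : Finset ℤ) := by
  by_cases h : G.graph.Adj u v
  · rw [G.signedAdj_of_adj h]
    rcases Int.units_eq_one_or (G.sign.get u v h) with h' | h' <;> simp [h']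
  · simp [G.signedAdj_of_not_adj h]

/-- A homomorphism of signed graphs preserves the signs of closed walks of length four. -/
theorem PreservesClosedWalkSigns.quad_eq {G : SignedGraph V} {H : SignedGraph W}
    {f : G.graph →g H.graph} (hf : PreservesClosedWalkSigns G H f) {x v y w : V}
    (h : quad G.signedAdj x v y w ≠ 0) :
    quad H.signedAdj (f x) (f v) (f y) (f w) = quad G.signedAdj x v y w := by
  have hxv := G.adj_of_signedAdj_ne_zero (fun h0 => h (by simp [quad, h0]) : G.signedAdj x v ≠ 0)
  have hvy := G.adj_of_signedAdj_ne_zero (fun h0 => h (by simp [quad, h0]) : G.signedAdj v y ≠ 0)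
  have hxw := G.adj_of_signedAdj_ne_zero (fun h0 => h (by simp [quad, h0]) : G.signedAdj x w ≠ 0)
  have hwy := G.adj_of_signedAdj_ne_zero (fun h0 => h (by simp [quad, h0]) : G.signedAdj w y ≠ 0)
  have key := hf x (.cons hxv (.cons hvy (.cons hwy.symm (.cons hxw.symm .nil))))
  simp only [SimpleGraph.Walk.map_cons, SimpleGraph.Walk.map_nil, walkSign, mul_one] at key
  simp only [quad]
  rw [H.signedAdj_comm (f x) (f w), H.signedAdj_comm (f w) (f y), G.signedAdj_comm x w,
    G.signedAdj_comm w y, G.signedAdj_of_adj hxv, G.signedAdj_of_adj hvy,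
    G.signedAdj_of_adj hwy.symm, G.signedAdj_of_adj hxw.symm, H.signedAdj_of_adj (f.map_adj hxv),
    H.signedAdj_of_adj (f.map_adj hvy), H.signedAdj_of_adj (f.map_adj hwy.symm),
    H.signedAdj_of_adj (f.map_adj hxw.symm)]
  have key' := congrArg (Units.val : ℤˣ → ℤ) key
  push_cast at key'
  linear_combination key'

/-- Along a walk the switching factors cancel at every inner vertex, leaving only those of the two
ends; on a closed walk these cancel as well. -/
theorem preservesClosedWalkSigns_of_switching {G : SignedGraph V} {H : SignedGraph W}
    (f : G.graph →g H.graph) (s : V → ℤˣ)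
    (hs : ∀ u v, H.signedAdj (f u) (f v) = s u * s v * G.signedAdj u v) :
    PreservesClosedWalkSigns G H f := by
  have key : ∀ {u v : V} (p : G.graph.Walk u v),
      H.walkSign (p.map f) = s u * s v * G.walkSign p := by
    intro u v p
    induction p with
    | nil => simp [walkSign, Int.units_mul_self]
    | @cons u v w h p ih =>
      have h1 := hs u v
      rw [G.signedAdj_of_adj h, H.signedAdj_of_adj (f.map_adj h)] at h1
      have h2 : H.sign.get _ _ (f.map_adj h) = s u * s v * G.sign.get u v h := by
        ext; push_cast; exact h1
      simp only [SimpleGraph.Walk.map_cons, walkSign, ih, h2]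
      calc s u * s v * G.sign.get u v h * (s v * s w * G.walkSign p)
          = s u * s w * (G.sign.get u v h * G.walkSign p) * (s v * s v) := by
            simp only [mul_assoc, mul_comm, mul_left_comm]
        _ = _ := by rw [Int.units_mul_self, mul_one]
  intro v p
  rw [key, Int.units_mul_self, one_mul]

/-- Two signed graphs are isomorphic if their signed adjacency matrices agree up to a bijection of
the vertices and switching. -/
theorem isIsomorphic_of_switching {G : SignedGraph V} {H : SignedGraph W} (e : V ≃ W)
    (s : V → ℤˣ) (hs : ∀ u v, H.signedAdj (e u) (e v) = s u * s v * G.signedAdj u v) :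
    G.IsIsomorphic H := by
  have hadj : ∀ {u v}, H.graph.Adj (e u) (e v) ↔ G.graph.Adj u v := by
    intro u v
    rw [← signedAdj_ne_zero_iff, ← signedAdj_ne_zero_iff, hs]
    simp
  refine ⟨⟨e, hadj⟩, preservesClosedWalkSigns_of_switching _ s hs,
    preservesClosedWalkSigns_of_switching _ (s ∘ e.symm) fun u v => ?_⟩
  have h := hs (e.symm u) (e.symm v)
  rw [e.apply_symm_apply, e.apply_symm_apply] at h
  change G.signedAdj (e.symm u) (e.symm v) = _
  have h1 : ∀ x : ℤˣ, (x : ℤ) * x = 1 := fun x => by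
    rw [← Units.val_mul, Int.units_mul_self, Units.val_one]
  simp only [Function.comp, h]
  linear_combination (-G.signedAdj (e.symm u) (e.symm v)) * h1 (s (e.symm u)) -
    G.signedAdj (e.symm u) (e.symm v) * (s (e.symm u) : ℤ) * s (e.symm u) * h1 (s (e.symm v))

end signedAdj

/-! ### Balanced pairs in a target on six vertices -/

section quad

variable {V W : Type*} {S : W → W → ℤ}

/-- If the opposite vertices coincide, the product is a square. -/
theorem ne_of_quad_eq_neg_one (hS : ∀ u v, S u v = S v u) {a v b w : W}
    (h : quad S a v b w = -1) : a ≠ b := by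
  rintro rfl
  have : quad S a v a w = (S a v * S a w) ^ 2 := by
    rw [quad, hS v, hS w]; ring
  nlinarith [sq_nonneg (S a v * S a w)]

/-- In a signed graph with signed adjacency matrix `S`, all vertices other than `a` and `b` are
adjacent to both `a` and `b`, and half of these common neighbours yield paths of each sign. -/
def IsBalancedPair [Fintype W] (S : W → W → ℤ) (a b : W) : Prop :=
  a ≠ b ∧ (∀ w, w ≠ a → w ≠ b → S a w ≠ 0 ∧ S w b ≠ 0) ∧ ∑ w, S a w * S w b = 0

instance [Fintype W] [DecidableEq W] (S : W → W → ℤ) (a b : W) :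
    Decidable (IsBalancedPair S a b) := by
  unfold IsBalancedPair; infer_instance

theorem IsBalancedPair.symm [Fintype W] (hS : ∀ u v, S u v = S v u) {a b : W}
    (h : IsBalancedPair S a b) : IsBalancedPair S b a := by
  refine ⟨h.1.symm, fun w hb ha => ?_, ?_⟩
  · rw [hS b w, hS w a]; exact (h.2.1 w ha hb).symm
  · rw [← h.2.2]
    exact Finset.sum_congr rfl fun w _ => by rw [hS b w, hS w a, mul_comm]

/-- Being a balanced pair is invariant under relabelling and switching. -/
theorem IsBalancedPair.switch [Fintype W] [Fintype V] (e : V ≃ W) {s : V → ℤ}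
    (hs : ∀ i, s i * s i = 1) {i j : V} (h : IsBalancedPair S (e i) (e j)) :
    IsBalancedPair (fun i j => s i * s j * S (e i) (e j)) i j := by
  have hs0 : ∀ i, s i ≠ 0 := fun i h0 => by simpa [h0] using hs i
  refine ⟨fun hij => h.1 (by rw [hij]), fun w hi hj => ?_, ?_⟩
  · have := h.2.1 (e w) (by simpa using hi) (by simpa using hj)
    simp [hs0, this]
  · calc ∑ w, s i * s w * S (e i) (e w) * (s w * s j * S (e w) (e j))
        = ∑ w, s i * s j * (S (e i) (e w) * S (e w) (e j)) :=
          Finset.sum_congr rfl fun w _ => by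
            linear_combination (s i * s j * (S (e i) (e w) * S (e w) (e j))) * hs w
      _ = s i * s j * ∑ w, S (e i) w * S w (e j) := by
          rw [← Finset.mul_sum, e.sum_comp fun w => S (e i) w * S w (e j)]
      _ = 0 := by rw [h.2.2, mul_zero]

/-- `v₀, …, v₃` are common neighbours of `x` and `y`, the first two with paths of one sign and the
last two with paths of the other sign. -/
def IsSplit (A : V → V → ℤ) (x y v₀ v₁ v₂ v₃ : V) : Prop :=
  quad A x v₀ y v₁ = 1 ∧ quad A x v₁ y v₂ = -1 ∧ quad A x v₂ y v₃ = 1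

instance (A : V → V → ℤ) (x y v₀ v₁ v₂ v₃ : V) : Decidable (IsSplit A x y v₀ v₁ v₂ v₃) := by
  unfold IsSplit; infer_instance

/-- A configuration that forces a pair of vertices to be mapped to a balanced pair of a target
on six vertices. -/
def HasBalancer (A : V → V → ℤ) (x y : V) : Prop :=
  ∃ v₀ v₁ v₂ v₃ z z', IsSplit A x y v₀ v₁ v₂ v₃ ∧
    quad A v₀ x v₁ z = -1 ∧ quad A v₂ x v₃ z' = -1

/-- A splitting with a balancer between common neighbours of the same sign. -/
def HasDoubleBalancer (A : V → V → ℤ) (x y : V) : Prop :=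
  ∃ v₀ v₁ v₂ v₃, IsSplit A x y v₀ v₁ v₂ v₃ ∧ HasBalancer A v₀ v₁ ∧ HasBalancer A v₂ v₃

/-- Neighbours giving paths of different signs are distinct automatically; those of equal sign are
distinct by hypothesis. The six vertices then exhaust the target, so nothing else contributes to the
sum over common neighbours. -/
theorem IsSplit.exists_equiv [Fintype W] (hcard : Fintype.card W = 6)
    (hS : ∀ u v, S u v = S v u) (hS0 : ∀ u, S u u = 0) {a b v₀ v₁ v₂ v₃ : W}
    (h : IsSplit S a b v₀ v₁ v₂ v₃) (h01 : v₀ ≠ v₁) (h23 : v₂ ≠ v₃) :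
    IsBalancedPair S a b ∧ S a v₀ * S v₀ b = S a v₁ * S v₁ b ∧
      S a v₂ * S v₂ b = S a v₃ * S v₃ b ∧ ∃ e : Fin 6 ≃ W, ⇑e = ![a, b, v₀, v₁, v₂, v₃] := by
  obtain ⟨h1, h2, h3⟩ := h
  have hab := ne_of_quad_eq_neg_one hS h2
  simp only [quad] at h1 h2 h3
  obtain ⟨c₀, hc₀⟩ : ∃ c, S a v₀ * S v₀ b = c := ⟨_, rfl⟩
  obtain ⟨c₁, hc₁⟩ : ∃ c, S a v₁ * S v₁ b = c := ⟨_, rfl⟩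
  obtain ⟨c₂, hc₂⟩ : ∃ c, S a v₂ * S v₂ b = c := ⟨_, rfl⟩
  obtain ⟨c₃, hc₃⟩ : ∃ c, S a v₃ * S v₃ b = c := ⟨_, rfl⟩
  rw [hc₀, hc₁] at h1
  rw [hc₁, hc₂] at h2
  rw [hc₂, hc₃] at h3
  have hc : (c₀ = c₁ ∧ c₂ = -c₁ ∧ c₃ = -c₁) ∧ c₁ ≠ 0 := by
    rcases Int.mul_eq_one_iff_eq_one_or_neg_one.1 h1 with ⟨rfl, rfl⟩ | ⟨rfl, rfl⟩ <;>
      rcases Int.mul_eq_one_iff_eq_one_or_neg_one.1 h3 with ⟨rfl, rfl⟩ | ⟨rfl, rfl⟩ <;>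
      simp at h2 ⊢
  obtain ⟨⟨rfl, rfl, rfl⟩, hc0⟩ := hc
  have hne : ∀ v, S a v * S v b ≠ 0 → a ≠ v ∧ b ≠ v := fun v hv =>
    ⟨fun h => hv (by rw [← h, hS0, zero_mul]), fun h => hv (by rw [← h, hS0, mul_zero])⟩
  have hv₀ := hne v₀ (by rwa [hc₀])
  have hv₁ := hne v₁ (by rwa [hc₁])
  have hv₂ := hne v₂ (by rw [hc₂]; simpa)
  have hv₃ := hne v₃ (by rw [hc₃]; simpa)
  have hdiff : ∀ v w, S a v * S v b = c₀ → S a w * S w b = -c₀ → v ≠ w := by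
    rintro v _ h h' rfl
    omega
  have h02 := hdiff v₀ v₂ hc₀ hc₂
  have h03 := hdiff v₀ v₃ hc₀ hc₃
  have h12 := hdiff v₁ v₂ hc₁ hc₂
  have h13 := hdiff v₁ v₃ hc₁ hc₃
  have hinj : Function.Injective ![a, b, v₀, v₁, v₂, v₃] := by
    rw [← List.nodup_ofFn]
    simp [List.ofFn_succ, hab, hv₀, hv₁, hv₂, hv₃, h01, h02, h03, h12, h13, h23]
  let e : Fin 6 ≃ W := Equiv.ofBijective _
    ((Fintype.bijective_iff_injective_and_card _).2 ⟨hinj, by simp [hcard]⟩)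
  have he : ⇑e = ![a, b, v₀, v₁, v₂, v₃] := rfl
  have hmul : ∀ v, S a v * S v b ≠ 0 → S a v ≠ 0 ∧ S v b ≠ 0 := fun v hv =>
    ⟨left_ne_zero_of_mul hv, right_ne_zero_of_mul hv⟩
  refine ⟨⟨hab, ?_, ?_⟩, by rw [hc₀, hc₁], by rw [hc₂, hc₃], e, he⟩
  · intro w
    obtain ⟨i, rfl⟩ := e.surjective w
    rw [he]
    fin_cases i
    · simp
    · simp
    · intro _ _; exact hmul v₀ (by rwa [hc₀])
    · intro _ _; exact hmul v₁ (by rwa [hc₁])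
    · intro _ _; exact hmul v₂ (by rw [hc₂]; simpa)
    · intro _ _; exact hmul v₃ (by rw [hc₃]; simpa)
  · rw [← e.sum_comp, he, Fin.sum_univ_six]
    simp [hc₀, hc₁, hc₂, hc₃, hS0]

theorem HasBalancer.isBalancedPair [Fintype W] (hcard : Fintype.card W = 6)
    (hS : ∀ u v, S u v = S v u) (hS0 : ∀ u, S u u = 0) {a b : W} (h : HasBalancer S a b) :
    IsBalancedPair S a b := by
  obtain ⟨v₀, v₁, v₂, v₃, z, z', hv, hz, hz'⟩ := h
  exact (hv.exists_equiv hcard hS hS0 (ne_of_quad_eq_neg_one hS hz)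
    (ne_of_quad_eq_neg_one hS hz')).1

section map

variable {A : V → V → ℤ} {f : V → W}

theorem IsSplit.map {x y v₀ v₁ v₂ v₃ : V}
    (hf : ∀ x v y w, quad A x v y w ≠ 0 → quad S (f x) (f v) (f y) (f w) = quad A x v y w)
    (h : IsSplit A x y v₀ v₁ v₂ v₃) :
    IsSplit S (f x) (f y) (f v₀) (f v₁) (f v₂) (f v₃) := by
  obtain ⟨h1, h2, h3⟩ := h
  exact ⟨by rw [hf _ _ _ _ (by simp [h1]), h1], by rw [hf _ _ _ _ (by simp [h2]), h2],
    by rw [hf _ _ _ _ (by simp [h3]), h3]⟩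

theorem HasBalancer.map {x y : V}
    (hf : ∀ x v y w, quad A x v y w ≠ 0 → quad S (f x) (f v) (f y) (f w) = quad A x v y w)
    (h : HasBalancer A x y) :
    HasBalancer S (f x) (f y) := by
  obtain ⟨v₀, v₁, v₂, v₃, z, z', hv, hz, hz'⟩ := h
  exact ⟨f v₀, f v₁, f v₂, f v₃, f z, f z', hv.map hf, by rw [hf _ _ _ _ (by simp [hz]), hz],
    by rw [hf _ _ _ _ (by simp [hz']), hz']⟩

theorem HasDoubleBalancer.map {x y : V}
    (hf : ∀ x v y w, quad A x v y w ≠ 0 → quad S (f x) (f v) (f y) (f w) = quad A x v y w)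
    (h : HasDoubleBalancer A x y) :
    HasDoubleBalancer S (f x) (f y) := by
  obtain ⟨v₀, v₁, v₂, v₃, hv, h01, h23⟩ := h
  exact ⟨f v₀, f v₁, f v₂, f v₃, hv.map hf, h01.map hf, h23.map hf⟩

end map

/-- The inner balancers supply the distinctness needed to apply `IsSplit.exists_equiv` to the outer
splitting. The result is a partition into three balanced pairs. -/
theorem HasDoubleBalancer.exists_equiv [Fintype W] (hcard : Fintype.card W = 6)
    (hS : ∀ u v, S u v = S v u) (hS0 : ∀ u, S u u = 0) {a b : W} (h : HasDoubleBalancer S a b) :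
    IsBalancedPair S a b ∧ ∃ e : Fin 6 ≃ W, e 0 = a ∧ e 1 = b ∧
      S a (e 2) * S (e 2) b = S a (e 3) * S (e 3) b ∧
      S a (e 4) * S (e 4) b = S a (e 5) * S (e 5) b ∧
      IsBalancedPair S (e 2) (e 3) ∧ IsBalancedPair S (e 4) (e 5) := by
  obtain ⟨v₀, v₁, v₂, v₃, hv, h01, h23⟩ := h
  have h01' := h01.isBalancedPair hcard hS hS0
  have h23' := h23.isBalancedPair hcard hS hS0
  obtain ⟨h1, h2, h3, e, he⟩ := hv.exists_equiv hcard hS hS0 h01'.1 h23'.1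
  refine ⟨h1, e, ?_⟩
  rw [he]
  exact ⟨rfl, rfl, h2, h3, h01', h23'⟩

/-- Every vertex outside of a doubly balanced pair is in a balanced pair with another such vertex
of the same sign. -/
theorem HasDoubleBalancer.exists_partner [Fintype W] (hcard : Fintype.card W = 6)
    (hS : ∀ u v, S u v = S v u) (hS0 : ∀ u, S u u = 0) {a d : W} (h : HasDoubleBalancer S a d)
    {b : W} (hba : b ≠ a) (hbd : b ≠ d) :
    ∃ w, w ≠ a ∧ w ≠ d ∧ S a b * S b d = S a w * S w d ∧ IsBalancedPair S b w := by
  obtain ⟨-, e, rfl, rfl, h1, h2, h3, h4⟩ := h.exists_equiv hcard hS hS0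
  obtain ⟨i, rfl⟩ := e.surjective b
  fin_cases i
  · exact absurd rfl hba
  · exact absurd rfl hbd
  · exact ⟨e 3, by simp, by simp, h1, h3⟩
  · exact ⟨e 2, by simp, by simp, h1.symm, h3.symm hS⟩
  · exact ⟨e 5, by simp, by simp, h2, h4⟩
  · exact ⟨e 4, by simp, by simp, h2.symm, h4.symm hS⟩

end quad

end SignedGraph

/-! ### Straight-line drawings with decidable non-crossing conditions -/

/-- A straight-line segment, parametrized by the unit interval. -/
def segmentPath (P Q : ℝ × ℝ) : Path P Q where
  toFun t := AffineMap.lineMap P Q (t : ℝ)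
  continuous_toFun := by
    have : Continuous fun t : ℝ => AffineMap.lineMap P Q t := AffineMap.lineMap_continuous
    exact this.comp continuous_subtype_val
  source' := by simp
  target' := by simp

theorem range_segmentPath (P Q : ℝ × ℝ) : Set.range (segmentPath P Q) = segment ℝ P Q := by
  rw [segment_eq_image_lineMap]
  ext p
  constructor
  · rintro ⟨t, rfl⟩; exact ⟨t, t.2, rfl⟩
  · rintro ⟨t, ht, rfl⟩; exact ⟨⟨t, ht⟩, rfl⟩

theorem segmentPath_injective {P Q : ℝ × ℝ} (h : P ≠ Q) : Function.Injective (segmentPath P Q) :=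
  fun _ _ hst => Subtype.ext (AffineMap.lineMap_injective ℝ h hst)

/-- If two segments with a common end meet elsewhere, then one of them contains the other end
of the other one. -/
theorem eq_of_mem_segment_of_mem_segment {P Q R p : ℝ × ℝ} (hQ : Q ∉ segment ℝ P R)
    (hR : R ∉ segment ℝ P Q) (hpQ : p ∈ segment ℝ P Q) (hpR : p ∈ segment ℝ P R) : p = P := by
  rw [segment_eq_image_lineMap] at hQ hR hpQ hpR
  obtain ⟨s, ⟨hs0, hs1⟩, rfl⟩ := hpQ
  obtain ⟨t, ⟨ht0, ht1⟩, hst⟩ := hpR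
  -- The nearer far end has the larger parameter: a point with parameter `t` on `PR` and `s ≤ t` on
  -- `PQ` puts `R` at parameter `s / t` on `PQ`.
  have aux : ∀ {s t : ℝ} {Q R : ℝ × ℝ}, 0 ≤ s → s ≤ t → t ≠ 0 →
      AffineMap.lineMap P R t = AffineMap.lineMap P Q s →
      R ∈ (AffineMap.lineMap P Q : ℝ → ℝ × ℝ) '' Set.Icc 0 1 := by
    intro s t Q R hs hst ht h
    have htpos : 0 < t := lt_of_le_of_ne (hs.trans hst) ht.symm
    refine ⟨s / t, ⟨by positivity, (div_le_one htpos).2 hst⟩, ?_⟩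
    simp only [AffineMap.lineMap_apply_module', Prod.ext_iff, Prod.fst_add, Prod.snd_add,
      Prod.smul_fst, Prod.smul_snd, Prod.fst_sub, Prod.snd_sub, smul_eq_mul] at h ⊢
    constructor
    · field_simp; linear_combination -h.1
    · field_simp; linear_combination -h.2
  rcases eq_or_ne s 0 with rfl | hs
  · simp
  rcases eq_or_ne t 0 with rfl | ht
  · rw [← hst]; simp
  rcases le_total s t with h | h
  · exact absurd (aux hs0 h ht hst) hR
  · exact absurd (aux ht0 h hs hst.symm) hQ

/-- The line with normal vector `(c, d)` strictly separates the segments `PQ` and `RS`. -/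
def Separates (c d : ℤ) (P Q R S : ℤ × ℤ) : Prop :=
  max (c * P.1 + d * P.2) (c * Q.1 + d * Q.2) < min (c * R.1 + d * R.2) (c * S.1 + d * S.2) ∨
  max (c * R.1 + d * R.2) (c * S.1 + d * S.2) < min (c * P.1 + d * P.2) (c * Q.1 + d * Q.2)

instance (c d : ℤ) (P Q R S : ℤ × ℤ) : Decidable (Separates c d P Q R S) := by
  unfold Separates; infer_instance

/-- The two segments are separated by a coordinate line or by a line parallel to one of them. -/
def SegmentsSeparated (P Q R S : ℤ × ℤ) : Prop :=
  Separates 1 0 P Q R S ∨ Separates 0 1 P Q R S ∨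
    Separates (Q.2 - P.2) (P.1 - Q.1) P Q R S ∨ Separates (S.2 - R.2) (R.1 - S.1) P Q R S

instance (P Q R S : ℤ × ℤ) : Decidable (SegmentsSeparated P Q R S) := by
  unfold SegmentsSeparated; infer_instance

/-- The integer point `P` as a point of the real plane. -/
def realPoint (P : ℤ × ℤ) : ℝ × ℝ := (P.1, P.2)

theorem realPoint_injective : Function.Injective realPoint := fun P Q h => by
  simpa [realPoint, Prod.ext_iff] using h

/-- A linear functional on a segment lies between its values at the two ends, so separated end
values exclude a common point. -/
theorem Separates.not_mem {c d : ℤ} {P Q R S : ℤ × ℤ} (h : Separates c d P Q R S) {p : ℝ × ℝ}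
    (hp : p ∈ segment ℝ (realPoint P) (realPoint Q)) :
    p ∉ segment ℝ (realPoint R) (realPoint S) := by
  rintro ⟨t, t', ht, ht', htt, rfl⟩
  obtain ⟨s, s', hs, hs', hss, h'⟩ := hp
  have lower : ∀ {m : ℤ} {A B : ℤ × ℤ} {u u' : ℝ}, 0 ≤ u → 0 ≤ u' → u + u' = 1 →
      m ≤ c * A.1 + d * A.2 → m ≤ c * B.1 + d * B.2 →
      (m : ℝ) ≤ c * (u * A.1 + u' * B.1) + d * (u * A.2 + u' * B.2) := by
    intro m A B u u' hu hu' huu hA hB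
    have hA' : (m : ℝ) ≤ c * A.1 + d * A.2 := by exact_mod_cast hA
    have hB' : (m : ℝ) ≤ c * B.1 + d * B.2 := by exact_mod_cast hB
    have e : (m : ℝ) = u * m + u' * m := by rw [← add_mul, huu, one_mul]
    rw [e]
    linarith [mul_le_mul_of_nonneg_left hA' hu, mul_le_mul_of_nonneg_left hB' hu']
  have upper : ∀ {m : ℤ} {A B : ℤ × ℤ} {u u' : ℝ}, 0 ≤ u → 0 ≤ u' → u + u' = 1 →
      c * A.1 + d * A.2 ≤ m → c * B.1 + d * B.2 ≤ m →
      c * (u * A.1 + u' * B.1) + d * (u * A.2 + u' * B.2) ≤ (m : ℝ) := by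
    intro m A B u u' hu hu' huu hA hB
    have hA' : c * A.1 + d * A.2 ≤ (m : ℝ) := by exact_mod_cast hA
    have hB' : c * B.1 + d * B.2 ≤ (m : ℝ) := by exact_mod_cast hB
    have e : (m : ℝ) = u * m + u' * m := by rw [← add_mul, huu, one_mul]
    rw [e]
    linarith [mul_le_mul_of_nonneg_left hA' hu, mul_le_mul_of_nonneg_left hB' hu']
  have h1 : s * (P.1 : ℝ) + s' * Q.1 = t * R.1 + t' * S.1 := by
    simpa [realPoint] using congrArg Prod.fst h'
  have h2 : s * (P.2 : ℝ) + s' * Q.2 = t * R.2 + t' * S.2 := by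
    simpa [realPoint] using congrArg Prod.snd h'
  rcases h with h | h
  · have l1 := upper hs hs' hss (le_max_left (c * P.1 + d * P.2) (c * Q.1 + d * Q.2))
      (le_max_right _ _)
    have l2 := lower ht ht' htt (min_le_left (c * R.1 + d * R.2) (c * S.1 + d * S.2))
      (min_le_right _ _)
    rw [h1, h2] at l1
    exact absurd (by exact_mod_cast l2.trans l1) (not_le.2 h)
  · have l1 := lower hs hs' hss (min_le_left (c * P.1 + d * P.2) (c * Q.1 + d * Q.2))
      (min_le_right _ _)
    have l2 := upper ht ht' htt (le_max_left (c * R.1 + d * R.2) (c * S.1 + d * S.2))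
      (le_max_right _ _)
    rw [h1, h2] at l1
    exact absurd (by exact_mod_cast l1.trans l2) (not_le.2 h)

theorem SegmentsSeparated.not_mem {P Q R S : ℤ × ℤ} (h : SegmentsSeparated P Q R S) {p : ℝ × ℝ}
    (hp : p ∈ segment ℝ (realPoint P) (realPoint Q)) :
    p ∉ segment ℝ (realPoint R) (realPoint S) := by
  rcases h with h | h | h | h <;> exact h.not_mem hp

/-- A straight-line drawing on integer points: edges are given by a list `E` that contains every
edge in one of its two orientations. -/
theorem isPlanarGraph_of_segmentsSeparated {n : ℕ} {G : SimpleGraph (Fin n)} (E : List (ℕ × ℕ))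
    (hE : ∀ u v : Fin n, G.Adj u v → ((u : ℕ), (v : ℕ)) ∈ E ∨ ((v : ℕ), (u : ℕ)) ∈ E)
    (pos : ℕ → ℤ × ℤ) (hpos : ∀ u < n, ∀ v < n, pos u = pos v → u = v)
    (hvertex : ∀ e ∈ E, ∀ w < n, w = e.1 ∨ w = e.2 ∨
      SegmentsSeparated (pos e.1) (pos e.2) (pos w) (pos w))
    (hedge : ∀ e ∈ E, ∀ e' ∈ E, (e.1 = e'.1 ∨ e.1 = e'.2 ∨ e.2 = e'.1 ∨ e.2 = e'.2) ∨
      SegmentsSeparated (pos e.1) (pos e.2) (pos e'.1) (pos e'.2)) :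
    IsPlanarGraph G := by
  have hinj : Function.Injective fun v : Fin n => realPoint (pos v) := fun u v h =>
    Fin.ext (hpos u u.2 v v.2 (realPoint_injective h))
  let arc : Sym2 (Fin n) → Set (ℝ × ℝ) := Sym2.lift
    ⟨fun u v => segment ℝ (realPoint (pos u)) (realPoint (pos v)), fun _ _ => segment_symm _ _ _⟩
  have hmem : ∀ e ∈ G.edgeSet,
      ∃ u v : Fin n, ((u : ℕ), (v : ℕ)) ∈ E ∧ e = s(u, v) ∧ G.Adj u v := by
    intro e
    induction e with
    | h u v =>
      intro h
      rcases hE u v h with h' | h'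
      · exact ⟨u, v, h', rfl, h⟩
      · exact ⟨v, u, h', Sym2.eq_swap, SimpleGraph.Adj.symm h⟩
  have hv : ∀ e ∈ G.edgeSet, ∀ w : Fin n, realPoint (pos w) ∈ arc e → w ∈ e := by
    intro e he w hw
    obtain ⟨u, v, huv, rfl, -⟩ := hmem e he
    rcases hvertex _ huv w w.2 with h | h | h
    · simp [Fin.ext h]
    · simp [Fin.ext h]
    · exact absurd (left_mem_segment ℝ _ _) (h.not_mem hw)
  -- Edges with a common end are exempt from `hedge`. The vertex condition suffices for them:
  -- neither segment contains the far end of the other.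
  have hshare : ∀ u v w, G.Adj u v → G.Adj u w → v ≠ w → ∀ p ∈ arc s(u, v) ∩ arc s(u, w),
      p = realPoint (pos u) := by
    intro u v w huv huw hvw p hp
    refine eq_of_mem_segment_of_mem_segment (fun h => ?_) (fun h => ?_) hp.1 hp.2
    · rcases Sym2.mem_iff.1 (hv s(u, w) huw v h) with h' | h'
      exacts [huv.ne h'.symm, hvw h']
    · rcases Sym2.mem_iff.1 (hv s(u, v) huv w h) with h' | h'
      exacts [huw.ne h'.symm, hvw h'.symm]
  refine ⟨⟨fun v : Fin n => realPoint (pos v), arc, hinj, fun u v h => ?_, hv, ?_⟩⟩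
  · exact ⟨segmentPath _ _, segmentPath_injective fun h' => h.ne (hinj h'), range_segmentPath _ _⟩
  · intro e he e' he' hne p hp
    obtain ⟨u, v, huv, rfl, hadj⟩ := hmem e he
    obtain ⟨u', v', huv', rfl, hadj'⟩ := hmem e' he'
    rcases hedge _ huv _ huv' with (h | h | h | h) | h
    · obtain rfl : u = u' := Fin.ext h
      exact ⟨u, by simp, by simp, hshare u v v' hadj hadj' (fun h => hne (by rw [h])) p hp⟩
    · obtain rfl : u = v' := Fin.ext h
      rw [Sym2.eq_swap (a := u')] at hp hne
      exact ⟨u, by simp, by simp, hshare u v u' hadj hadj'.symm (fun h => hne (by rw [h])) p hp⟩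
    · obtain rfl : v = u' := Fin.ext h
      rw [Sym2.eq_swap (a := u)] at hp hne
      exact ⟨v, by simp, by simp, hshare v u v' hadj.symm hadj' (fun h => hne (by rw [h])) p hp⟩
    · obtain rfl : v = v' := Fin.ext h
      rw [Sym2.eq_swap (a := u), Sym2.eq_swap (a := u')] at hp
      rw [Sym2.eq_swap (a := u), Sym2.eq_swap (a := u')] at hne
      exact ⟨v, by simp, by simp,
        hshare v u u' hadj.symm hadj'.symm (fun h => hne (by rw [h])) p hp⟩
    · exact absurd hp.2 (h.not_mem hp.1)

/-! ### The witness: construction, planarity and balancers -/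

namespace SignedGraph

/-- The signed graph with a given symmetric signed adjacency matrix. -/
def ofMatrix {V : Type*} (A : V → V → ℤ) (hA : ∀ u v, A u v = A v u) (hA0 : ∀ u, A u u = 0) :
    SignedGraph V where
  graph :=
    { Adj := fun u v => A u v ≠ 0
      symm := ⟨fun u v h => by rwa [hA v u]⟩
      loopless := ⟨fun u h => h (hA0 u)⟩ }
  sign := SimpleGraph.EdgeLabeling.mk (fun u v _ => if A u v = -1 then -1 else 1)
    (fun u v _ => by rw [hA u v])

theorem signedAdj_ofMatrix {V : Type*} (A : V → V → ℤ) (hA : ∀ u v, A u v = A v u)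
    (hA0 : ∀ u, A u u = 0) {u v : V} (h : A u v = 0 ∨ A u v = 1 ∨ A u v = -1) :
    (ofMatrix A hA hA0).signedAdj u v = A u v := by
  by_cases h0 : A u v = 0
  · have h' : ¬ (ofMatrix A hA hA0).graph.Adj u v := fun h' => absurd h0 h'
    rw [signedAdj_of_not_adj _ h', h0]
  · rw [signedAdj_of_adj _ (show (ofMatrix A hA hA0).graph.Adj u v from h0)]
    simp only [ofMatrix, SimpleGraph.EdgeLabeling.get_mk]
    rcases h with h | h | h
    · exact absurd h h0
    · simp [h]
    · simp [h]

section witness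

/-- The positive edges of a balancer between `a` and `b` on the vertices `k, …, k + 5`. -/
def balancerPos (a b k : ℕ) : List (ℕ × ℕ) :=
  [(a, k), (a, k + 1), (a, k + 2), (a, k + 3), (b, k), (b, k + 1), (k, k + 4), (k + 2, k + 5)]

/-- The negative edges of a balancer with end `b` on the vertices `k, …, k + 5`. -/
def balancerNeg (b k : ℕ) : List (ℕ × ℕ) :=
  [(b, k + 2), (b, k + 3), (k + 1, k + 4), (k + 3, k + 5)]

/-- The positive edges of a double balancer between `a` and `b` on the vertices `k, …, k + 15`. -/
def doubleBalancerPos (a b k : ℕ) : List (ℕ × ℕ) :=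
  [(a, k), (a, k + 1), (a, k + 2), (a, k + 3), (b, k), (b, k + 1)] ++
    balancerPos k (k + 1) (k + 4) ++ balancerPos (k + 2) (k + 3) (k + 10)

/-- The negative edges of a double balancer with end `b` on the vertices `k, …, k + 15`. -/
def doubleBalancerNeg (b k : ℕ) : List (ℕ × ℕ) :=
  [(b, k + 2), (b, k + 3)] ++
    balancerNeg (k + 1) (k + 4) ++ balancerNeg (k + 3) (k + 10)

/-- The positive edges of the witness: the vertex `0` is joined to both `1` and `2` by double
balancers, and `1` and `2` are opposite vertices of a negative 4-cycle. -/
def witnessPos : List (ℕ × ℕ) :=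
  [(1, 3), (3, 2), (1, 4)] ++ doubleBalancerPos 0 1 5 ++ doubleBalancerPos 0 2 21

/-- The negative edges of the witness. -/
def witnessNeg : List (ℕ × ℕ) :=
  [(4, 2)] ++ doubleBalancerNeg 1 5 ++ doubleBalancerNeg 2 21

/-- The signed adjacency matrix of the witness. -/
def witnessMatrix (i j : Fin 37) : ℤ :=
  if (i.val, j.val) ∈ witnessPos ∨ (j.val, i.val) ∈ witnessPos then 1
  else if (i.val, j.val) ∈ witnessNeg ∨ (j.val, i.val) ∈ witnessNeg then -1 else 0

theorem witnessMatrix_comm (i j : Fin 37) : witnessMatrix i j = witnessMatrix j i := by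
  simp only [witnessMatrix, or_comm]

theorem witnessMatrix_self : ∀ i, witnessMatrix i i = 0 := by
  decide +kernel

/-- A planar bipartite signed graph whose homomorphic images on six vertices are all switching
equivalent to `SP₅⁺`. -/
def witness : SignedGraph (Fin 37) :=
  ofMatrix witnessMatrix witnessMatrix_comm witnessMatrix_self

theorem witness_signedAdj : witness.signedAdj = witnessMatrix := by
  ext i j
  refine signedAdj_ofMatrix _ _ _ ?_
  unfold witnessMatrix
  split_ifs <;> simp

theorem mem_of_witness_adj {i j : Fin 37} (h : witness.graph.Adj i j) :
    (i.val, j.val) ∈ witnessPos ++ witnessNeg ∨ (j.val, i.val) ∈ witnessPos ++ witnessNeg := by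
  by_contra h'
  simp only [List.mem_append, not_or] at h'
  exact h (by simp [witnessMatrix, h'])

/-- The positions of the inner vertices of a double balancer centred at `(c, 0)`. -/
def doubleBalancerPosition (c : ℤ) : List (ℤ × ℤ) :=
  [(c, 20), (c, 8), (c, -8), (c, -20),
    (c - 5, 14), (c - 1, 14), (c + 1, 14), (c + 5, 14), (c - 3, 14), (c + 3, 14),
    (c - 5, -14), (c - 1, -14), (c + 1, -14), (c + 5, -14), (c - 3, -14), (c + 3, -14)]

/-- The positions of the vertices in a straight-line drawing of the witness. -/
def witnessPosition (i : ℕ) : ℤ × ℤ :=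
  -- The lists have 5 + 16 + 16 = 37 entries, so no vertex receives the default value.
  ([(0, 0), (-80, 0), (80, 0), (0, -60), (0, 60)] ++ doubleBalancerPosition (-40) ++
    doubleBalancerPosition 40).getD i 0

/-- A bipartition of the witness. -/
def witnessColor (i : ℕ) : Bool :=
  i ∈ ([3, 4, 5, 6, 7, 8, 13, 14, 19, 20, 21, 22, 23, 24, 29, 30, 35, 36] : List ℕ)

theorem witness_isPlanarGraph : IsPlanarGraph witness.graph :=
  isPlanarGraph_of_segmentsSeparated (witnessPos ++ witnessNeg) (fun _ _ => mem_of_witness_adj)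
    witnessPosition (by decide +kernel) (by decide +kernel)
    (by decide +kernel)

theorem witness_triangleFreePlanar : triangleFreePlanar (Fin 37) witness.graph := by
  have hc : ∀ e ∈ witnessPos ++ witnessNeg, witnessColor e.1 ≠ witnessColor e.2 := by
    decide +kernel
  refine ⟨inferInstance, witness_isPlanarGraph, ?_⟩
  let C : witness.graph.Coloring Bool := SimpleGraph.Coloring.mk (fun i => witnessColor i)
      fun {i j} h => by
    rcases mem_of_witness_adj h with h | h
    exacts [hc _ h, (hc _ h).symm]
  exact C.colorable.cliqueFree (by simp)

/-- The indices follow the layout of `doubleBalancerPos` with `k = 5`: the outer splitting, then the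
two inner balancers with six vertices each. -/
theorem witness_hasDoubleBalancer_left : HasDoubleBalancer witnessMatrix 0 1 :=
  ⟨5, 6, 7, 8, by decide +kernel, ⟨9, 10, 11, 12, 13, 14, by decide +kernel⟩,
    ⟨15, 16, 17, 18, 19, 20, by decide +kernel⟩⟩

theorem witness_hasDoubleBalancer_right : HasDoubleBalancer witnessMatrix 0 2 :=
  ⟨21, 22, 23, 24, by decide +kernel, ⟨25, 26, 27, 28, 29, 30, by decide +kernel⟩,
    ⟨31, 32, 33, 34, 35, 36, by decide +kernel⟩⟩

theorem witness_quad : quad witnessMatrix 1 3 2 4 = -1 := by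
  decide +kernel

end witness

/-! ### Classification of the target -/

section target

/-- The matrices that arise from a doubly balanced pair after switching. -/
def normalForm (p q r t : ℤ) : Fin 6 → Fin 6 → ℤ :=
  ![![0, p, 1, 1, 1, 1], ![p, 0, 1, 1, -1, -1], ![1, 1, 0, q, t, -t], ![1, 1, q, 0, -t, t],
    ![1, -1, t, -t, 0, r], ![1, -1, -t, t, r, 0]]

/-- Balance of `(0, d)` makes `0` and `1` adjacent, so `p ≠ 0`, and its sum gives `q = -p` if `d` is
`2` or `3`, and `r = p` if `d` is `4` or `5`. The sign condition then puts `w` in the pair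
containing neither `1` nor `d`, and balance of `(1, w)` gives the other equation. The kernel checks
all cases. -/
theorem normalForm_eq : ∀ p ∈ ({-1, 0, 1} : Finset ℤ), ∀ q ∈ ({-1, 0, 1} : Finset ℤ),
    ∀ r ∈ ({-1, 0, 1} : Finset ℤ), ∀ t ∈ ({-1, 1} : Finset ℤ), ∀ d w : Fin 6,
    d ≠ 0 → d ≠ 1 → w ≠ 0 → w ≠ d →
    normalForm p q r t 0 1 * normalForm p q r t 1 d =
      normalForm p q r t 0 w * normalForm p q r t w d →
    IsBalancedPair (normalForm p q r t) 0 d → IsBalancedPair (normalForm p q r t) 1 w →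
    p ≠ 0 ∧ q = -p ∧ r = p := by
  decide +kernel

/-- The signed adjacency matrix of `SP₅⁺`. -/
def paleyPlusFiveMatrix : Option (ZMod 5) → Option (ZMod 5) → ℤ
  | none, none => 0
  | none, some _ => 1
  | some _, none => 1
  | some u, some v => if u = v then 0 else if u - v = 1 ∨ u - v = 4 then 1 else -1

theorem isSquare_zmod_five : ∀ x : ZMod 5, IsSquare x ↔ x = 0 ∨ x = 1 ∨ x = 4 := by
  unfold IsSquare
  decide

theorem paleyPlusFive_signedAdj : paleyPlusFive.signedAdj = paleyPlusFiveMatrix := by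
  ext u v
  match u, v with
  | none, none => exact signedAdj_self _ _
  | none, some v =>
    have h : paleyPlusFive.graph.Adj none (some v) := trivial
    rw [signedAdj_of_adj _ h]
    rfl
  | some v, none =>
    have h : paleyPlusFive.graph.Adj (some v) none := trivial
    rw [signedAdj_of_adj _ h]
    rfl
  | some u, some v =>
    by_cases huv : u = v
    · subst huv
      simp [signedAdj_self, paleyPlusFiveMatrix]
    · have h : paleyPlusFive.graph.Adj (some u) (some v) := huv
      have h0 : u - v ≠ 0 := sub_ne_zero.2 huv
      have h1 : IsSquare (u - v) → paleyPlusFive.sign.get _ _ h = 1 := fun hs => if_pos hs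
      have h2 : ¬ IsSquare (u - v) → paleyPlusFive.sign.get _ _ h = -1 := fun hs => if_neg hs
      simp only [isSquare_zmod_five, h0, false_or] at h1 h2
      simp only [signedAdj_of_adj _ h, paleyPlusFiveMatrix, huv, if_false]
      split_ifs with hs
      · simp [h1 hs]
      · simp [h2 hs]

theorem exists_equiv_normalForm {u t : ℤ} (hu : u = -1 ∨ u = 1) (ht : t = -1 ∨ t = 1) :
    ∃ (g : Fin 6 ≃ Option (ZMod 5)) (s : Fin 6 → ℤˣ), ∀ i j,
      paleyPlusFive.signedAdj (g i) (g j) = s i * s j * normalForm u (-u) u t i j := by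
  rw [paleyPlusFive_signedAdj]
  have key : ∀ g : Fin 6 → Option (ZMod 5), Function.Injective g → ∀ s : Fin 6 → ℤˣ,
      (∀ i j, paleyPlusFiveMatrix (g i) (g j) = s i * s j * normalForm u (-u) u t i j) →
      ∃ (g : Fin 6 ≃ Option (ZMod 5)) (s : Fin 6 → ℤˣ), ∀ i j,
      paleyPlusFiveMatrix (g i) (g j) = s i * s j * normalForm u (-u) u t i j :=
    fun g hg s h => ⟨Equiv.ofBijective g
      ((Fintype.bijective_iff_injective_and_card _).2 ⟨hg, by simp [ZMod.card]⟩), s, h⟩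
  -- The pair `0, 1` goes to `∞, 0`. For `u = 1` the squares `1, 4` are the common neighbours with
  -- positive paths; for `u = -1` the vertex `0` of the field is switched and the non-squares `2, 3`
  -- take that role. The order of the last pair realizes `t`.
  rcases hu with rfl | rfl <;> rcases ht with rfl | rfl
  · exact key ![none, some 0, some 2, some 3, some 4, some 1] (by unfold Function.Injective; decide)
      ![1, -1, 1, 1, 1, 1] (by decide +kernel)
  · exact key ![none, some 0, some 2, some 3, some 1, some 4] (by unfold Function.Injective; decide)
      ![1, -1, 1, 1, 1, 1] (by decide +kernel)
  · exact key ![none, some 0, some 1, some 4, some 3, some 2] (by unfold Function.Injective; decide)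
      1 (by decide +kernel)
  · exact key ![none, some 0, some 1, some 4, some 2, some 3] (by unfold Function.Injective; decide)
      1 (by decide +kernel)

theorem exists_switching_normalForm {W : Type*} [Fintype W] {S : W → W → ℤ}
    (hS : ∀ u v, S u v = S v u) (hS0 : ∀ u, S u u = 0)
    (hmem : ∀ u v, S u v ∈ ({-1, 0, 1} : Finset ℤ)) (e : Fin 6 ≃ W)
    (h01 : IsBalancedPair S (e 0) (e 1)) (h23 : IsBalancedPair S (e 2) (e 3))
    (h45 : IsBalancedPair S (e 4) (e 5))
    (hc : S (e 0) (e 2) * S (e 2) (e 1) = S (e 0) (e 3) * S (e 3) (e 1))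
    (hc' : S (e 0) (e 4) * S (e 4) (e 1) = S (e 0) (e 5) * S (e 5) (e 1)) :
    ∃ s : Fin 6 → ℤ, (∀ i, s i * s i = 1) ∧
      ∃ p ∈ ({-1, 0, 1} : Finset ℤ), ∃ q ∈ ({-1, 0, 1} : Finset ℤ),
      ∃ r ∈ ({-1, 0, 1} : Finset ℤ), ∃ t ∈ ({-1, 1} : Finset ℤ),
      (fun i j => s i * s j * S (e i) (e j)) = normalForm p q r t := by
  have sq : ∀ {u v}, S u v ≠ 0 → S u v * S u v = 1 := by
    intro u v h
    have := hmem u v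
    simp only [Finset.mem_insert, Finset.mem_singleton] at this
    rcases this with h' | h' | h' <;> simp_all
  have n01 : ∀ i : Fin 6, i ≠ 0 → i ≠ 1 → S (e 0) (e i) ≠ 0 ∧ S (e i) (e 1) ≠ 0 :=
    fun i h h' => h01.2.1 _ (e.injective.ne h) (e.injective.ne h')
  -- Switching at `2, …, 5` makes their edges to `0` positive; the factor at `1` is chosen to make
  -- the edge between `1` and `2` positive.
  let s : Fin 6 → ℤ := ![1, S (e 0) (e 2) * S (e 2) (e 1), S (e 0) (e 2), S (e 0) (e 3),
    S (e 0) (e 4), S (e 0) (e 5)]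
  have hs : ∀ i, s i * s i = 1 := by
    have h2 := sq (n01 2 (by decide) (by decide)).1
    have h2' := sq (n01 2 (by decide) (by decide)).2
    intro i
    fin_cases i
    · rfl
    · change S (e 0) (e 2) * S (e 2) (e 1) * (S (e 0) (e 2) * S (e 2) (e 1)) = 1
      rw [mul_mul_mul_comm, h2, h2', one_mul]
    · exact h2
    · exact sq (n01 3 (by decide) (by decide)).1
    · exact sq (n01 4 (by decide) (by decide)).1
    · exact sq (n01 5 (by decide) (by decide)).1
  refine ⟨s, hs, ?_⟩
  have b01 := h01.switch e hs
  have b23 := h23.switch e hs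
  have b45 := h45.switch e hs
  obtain ⟨N, hN⟩ : ∃ N : Fin 6 → Fin 6 → ℤ, N = fun i j => s i * s j * S (e i) (e j) := ⟨_, rfl⟩
  rw [← hN] at b01 b23 b45 ⊢
  have N_apply : ∀ i j, N i j = s i * s j * S (e i) (e j) := fun i j => by rw [hN]
  have Ncomm : ∀ i j, N i j = N j i := fun i j => by
    rw [N_apply, N_apply, hS (e i), mul_comm (s i)]
  have N0 : ∀ i, N i i = 0 := fun i => by rw [N_apply, hS0, mul_zero]
  have Nmem : ∀ i j, N i j = -1 ∨ N i j = 0 ∨ N i j = 1 := by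
    intro i j
    have h := hmem (e i) (e j)
    simp only [Finset.mem_insert, Finset.mem_singleton] at h
    rw [N_apply]
    have hsi := Int.mul_eq_one_iff_eq_one_or_neg_one.1 (hs i)
    have hsj := Int.mul_eq_one_iff_eq_one_or_neg_one.1 (hs j)
    rcases h with h | h | h <;> rcases hsi with ⟨h1, -⟩ | ⟨h1, -⟩ <;>
      rcases hsj with ⟨h2, -⟩ | ⟨h2, -⟩ <;> simp [h, h1, h2]
  have row : ∀ i : Fin 6, s i = S (e 0) (e i) → i ≠ 0 → i ≠ 1 → N 0 i = 1 := by
    intro i hi h h'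
    rw [N_apply, hi, show s 0 = 1 from rfl, one_mul, sq (n01 i h h').1]
  have N02 := row 2 rfl (by decide) (by decide)
  have N03 := row 3 rfl (by decide) (by decide)
  have N04 := row 4 rfl (by decide) (by decide)
  have N05 := row 5 rfl (by decide) (by decide)
  have Nc : N 0 2 * N 2 1 = N 0 3 * N 3 1 := by
    simp only [N_apply]
    linear_combination (s 0 * s 1 * (S (e 0) (e 2) * S (e 2) (e 1))) * hs 2 -
      (s 0 * s 1 * (S (e 0) (e 3) * S (e 3) (e 1))) * hs 3 + s 0 * s 1 * hc
  have Nc' : N 0 4 * N 4 1 = N 0 5 * N 5 1 := by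
    simp only [N_apply]
    linear_combination (s 0 * s 1 * (S (e 0) (e 4) * S (e 4) (e 1))) * hs 4 -
      (s 0 * s 1 * (S (e 0) (e 5) * S (e 5) (e 1))) * hs 5 + s 0 * s 1 * hc'
  have N21 : N 2 1 = 1 := by
    have h : s 1 = s 2 * S (e 2) (e 1) := rfl
    rw [N_apply]
    linear_combination hs 1 - s 1 * h
  have N31 : N 3 1 = 1 := by rw [N02, N03, N21] at Nc; omega
  have c01 := b01.2.2
  have c23 := b23.2.2
  have c45 := b45.2.2
  rw [Fin.sum_univ_six] at c01 c23 c45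
  rw [N02, N03, N04, N05, N21, N31, N0, N0] at c01
  rw [N04, N05] at Nc'
  have N41 : N 4 1 = -1 := by omega
  have N51 : N 5 1 = -1 := by omega
  rw [Ncomm 2 0, N02, N03, N21, Ncomm 1 3, N31, N0, N0, Ncomm 4 3, Ncomm 5 3] at c23
  rw [Ncomm 4 0, N04, N05, N41, Ncomm 1 5, N51, N0, N0, Ncomm 4 2, Ncomm 4 3] at c45
  -- In each of `c23` and `c45` the two outer vertices contribute `1 + 1`, so both remaining
  -- products are `-1`. This determines the 2 × 2 block up to the sign `N 2 4`.
  have hvals : (N 2 4 = -1 ∨ N 2 4 = 1) ∧ N 2 5 = -N 2 4 ∧ N 3 4 = -N 2 4 ∧ N 3 5 = N 2 4 := by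
    rcases Nmem 2 4 with h1 | h1 | h1 <;> rcases Nmem 2 5 with h2 | h2 | h2 <;>
      rcases Nmem 3 4 with h3 | h3 | h3 <;> rcases Nmem 3 5 with h4 | h4 | h4 <;>
      simp [h1, h2, h3, h4] at c23 c45 ⊢
  have hm : ∀ i j, N i j ∈ ({-1, 0, 1} : Finset ℤ) := by simpa using Nmem
  obtain ⟨h24, h25, h34, h35⟩ := hvals
  refine ⟨N 0 1, hm _ _, N 2 3, hm _ _, N 4 5, hm _ _, N 2 4, by simpa using h24, ?_⟩
  ext i j
  fin_cases i <;> fin_cases j <;>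
    simp [normalForm, N0, N02, N03, N04, N05, N21, N31, N41, N51, h25, h34, h35,
      Ncomm 1 0, Ncomm 2 0, Ncomm 3 0, Ncomm 4 0, Ncomm 5 0, Ncomm 1 2, Ncomm 1 3, Ncomm 1 4,
      Ncomm 1 5, Ncomm 3 2, Ncomm 4 2, Ncomm 5 2, Ncomm 4 3, Ncomm 5 3, Ncomm 5 4]

/-- A signed graph on six vertices with two doubly balanced pairs that share a vertex is
isomorphic to `SP₅⁺`. -/
theorem isIsomorphic_paleyPlusFive {W : Type*} [Fintype W] (T : SignedGraph W)
    (hcard : Fintype.card W = 6) {a b d : W} (hab : HasDoubleBalancer T.signedAdj a b)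
    (had : HasDoubleBalancer T.signedAdj a d) (hbd : b ≠ d) :
    T.IsIsomorphic paleyPlusFive := by
  have hS := T.signedAdj_comm
  have hS0 := T.signedAdj_self
  obtain ⟨h01, e, rfl, rfl, hc, hc', h23, h45⟩ := hab.exists_equiv hcard hS hS0
  obtain ⟨s, hs, p, hp, q, hq, r, hr, t, ht, hN⟩ :=
    exists_switching_normalForm hS hS0 T.signedAdj_mem e h01 h23 h45 hc hc'
  have hbal := (had.exists_equiv hcard hS hS0).1
  -- As `e 1` lies outside the second doubly balanced pair, it has a partner in the second
  -- partition.
  obtain ⟨w, hwa, hwd, hcw, hw⟩ := had.exists_partner hcard hS hS0 h01.1.symm hbd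
  obtain ⟨d, rfl⟩ := e.surjective d
  obtain ⟨w, rfl⟩ := e.surjective w
  have hbal' := hbal.switch e hs
  have hw' := hw.switch e hs
  have hN' : ∀ i j, s i * s j * T.signedAdj (e i) (e j) = normalForm p q r t i j :=
    fun i j => congrFun (congrFun hN i) j
  rw [hN] at hbal' hw'
  obtain ⟨hp0, rfl, rfl⟩ := normalForm_eq p hp q hq r hr t ht d w
    (fun h => hbal.1 (by rw [h])) (fun h => hbd (by rw [h])) (fun h => hwa (by rw [h]))
    (fun h => hwd (by rw [h])) (by
      simp only [← hN']
      linear_combination (s 0 * s d * (T.signedAdj (e 0) (e 1) * T.signedAdj (e 1) (e d))) * hs 1 -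
        (s 0 * s d * (T.signedAdj (e 0) (e w) * T.signedAdj (e w) (e d))) * hs w +
        s 0 * s d * hcw) hbal' hw'
  obtain ⟨g, s', hg⟩ := exists_equiv_normalForm (u := r) (t := t)
    (by simp at hp; omega) (by simpa using ht)
  let σ : Fin 6 → ℤˣ := fun i => ⟨s i, s i, hs i, hs i⟩
  -- Both graphs are switchings of one normal form, so the two switchings multiply.
  refine isIsomorphic_of_switching (e.symm.trans g) (fun v => s' (e.symm v) * σ (e.symm v))
    fun u v => ?_
  obtain ⟨i, rfl⟩ := e.surjective u
  obtain ⟨j, rfl⟩ := e.surjective v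
  simp only [Equiv.trans_apply, Equiv.symm_apply_apply, hg, ← hN', Units.val_mul, σ]
  ring

end target

end SignedGraph

theorem theorem1p9 {W : Type*} (T : SignedGraph W) (hcard : Nat.card W = 6)
    (hT : T.IsBound triangleFreePlanar) :
    T.IsIsomorphic SignedGraph.paleyPlusFive := by
  have : Finite W := Nat.finite_of_card_ne_zero (by omega)
  have := Fintype.ofFinite W
  obtain ⟨f, hf⟩ := hT (Fin 37) SignedGraph.witness SignedGraph.witness_triangleFreePlanar
  have hquad : ∀ x v y w, SignedGraph.quad SignedGraph.witnessMatrix x v y w ≠ 0 →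
      SignedGraph.quad T.signedAdj (f x) (f v) (f y) (f w) =
        SignedGraph.quad SignedGraph.witnessMatrix x v y w := by
    intro x v y w
    rw [← SignedGraph.witness_signedAdj]
    exact hf.quad_eq
  -- The negative 4-cycle through `1, 3, 2, 4` keeps the ends of the two double balancers apart.
  have hq : SignedGraph.quad T.signedAdj (f 1) (f 3) (f 2) (f 4) = -1 := by
    rw [hquad 1 3 2 4 (by rw [SignedGraph.witness_quad]; decide), SignedGraph.witness_quad]
  have hab : SignedGraph.HasDoubleBalancer T.signedAdj (f 0) (f 1) :=
    SignedGraph.witness_hasDoubleBalancer_left.map hquad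
  have had : SignedGraph.HasDoubleBalancer T.signedAdj (f 0) (f 2) :=
    SignedGraph.witness_hasDoubleBalancer_right.map hquad
  exact SignedGraph.isIsomorphic_paleyPlusFive T (by rwa [← Nat.card_eq_fintype_card]) hab had
    (SignedGraph.ne_of_quad_eq_neg_one T.signedAdj_comm hq)
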